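/- Let $n\ge 1$ and let $A$ be a real $n\times n$ matrix. A minor of $A$ is called principal if it is formed by the rows and the columns with the same indices $i_1<\dots<i_k$, and almost principal if it is obtained from such a square array by deleting the row $i_r$ and the column $i_s$ for some $r\ne s$ before taking the determinant. $A$ is called strictly Kotelyansky (SK) if all its principal and all its almost principal minors are positive. Theorem. Let $A$ be an $n\times n$ SK matrix. Then all the eigenvalues of $A$ are real, positive and (algebraically) simple: $$\rho(A)=\lambda_1>\lambda_2>\dots>\lambda_n>0,$$ where $\rho(A)$ is the spectral radius of $A$. Moreover, if $r=1$ or $r=n$, then the eigenvalues of the principal submatrix of $A$ obtained by deleting the $r$th row and the $r$th column are also real, positive and simple, $\mu^{(r)}_1>\mu^{(r)}_2>\dots>\mu^{(r)}_{n-1}>0$, and $$\lambda_j>\mu^{(r)}_j>\lambda_{j+1},\qquad j=1,\dots,n-1.$$ -/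

import Mathlib

/-- A real `n × n` matrix is *strictly Kotelyansky* (SK) if all its principal minors and all its
almost principal minors are positive. An index set `i_1 < ⋯ < i_k` is an order embedding
`f : Fin k ↪o Fin n`; an almost principal minor is obtained from the principal submatrix with
index set `i_1 < ⋯ < i_(k+1)` by deleting the row `i_r` and the column `i_s`, where `r ≠ s`. -/
structure IsSK {n : ℕ} (A : Matrix (Fin n) (Fin n) ℝ) : Prop where
  principal_pos : ∀ (k : ℕ) (f : Fin k ↪o Fin n), 0 < (A.submatrix f f).det
  almost_principal_pos : ∀ (k : ℕ) (f : Fin (k + 1) ↪o Fin n) (r s : Fin (k + 1)), r ≠ s →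
    0 < (A.submatrix (fun i => f (r.succAbove i)) (fun i => f (s.succAbove i))).det

/-- The eigenvalues of the real `n × n` matrix `A` (over `ℂ`, counted with algebraic multiplicity)
are exactly `ev 0 > ev 1 > ⋯ > ev (n - 1) > 0`; in particular they are real, positive, simple. -/
structure HasSimplePosEigenvalues {n : ℕ} (A : Matrix (Fin n) (Fin n) ℝ) (ev : Fin n → ℝ) :
    Prop where
  strictAnti : StrictAnti ev
  pos : ∀ i, 0 < ev i
  charpoly_eq : A.charpoly = ∏ i, (Polynomial.X - Polynomial.C (ev i))

/-- The matrix obtained from `A` by deleting the `r`th row and the `r`th column. -/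
def deleteRowCol {n : ℕ} (A : Matrix (Fin (n + 1)) (Fin (n + 1)) ℝ) (r : Fin (n + 1)) :
    Matrix (Fin n) (Fin n) ℝ :=
  A.submatrix r.succAbove r.succAbove

/-!
Write `φ(x) = det (x - A)`, let `φ₀` and `φ_ℓ` be the characteristic polynomials of `A` with its
first, respectively its last, row and column deleted, and `φ₀ℓ` that of the interior, where both
are deleted. The Desnanot–Jacobi identity (`Matrix.det_mul_det_interior`) reads
`φ φ₀ℓ = φ₀ φ_ℓ - ψ χ`, where `ψ` and `χ` are the two corner minors of `x - A`: first row and last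
column deleted, or last row and first column deleted.

Up to a common sign, `ψ(x)` and `χ(x)` are the corner minors of `A - x`. Expanding along the
shifted diagonal entries, each of which lies directly above or below the diagonal of the minor,
gives every power of `x` the coefficient `+1` times a sum of almost principal minors of `A`. So
both corner minors of `A - x` are positive for all `x ≥ 0`
(`IsSK.det_corner_sub_diagonal_pos`), and `φ φ₀ℓ < 0` at every nonnegative root of `φ₀ φ_ℓ`
(`IsSK.eval_charpoly_mul_eval_charpoly_interior_neg`).

The theorem follows by induction on the size. By induction the roots `μ_j` of `φ₀` (or of `φ_ℓ`)
are positive, simple and strictly interlaced with those of `φ₀ℓ`, so `φ₀ℓ` alternates in sign along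
them, and hence so does `φ`, with the opposite sign. As `φ` is monic and `(-1)ⁿ φ(0) = det A > 0`,
where `n` is the size of `A`, the intermediate value theorem yields one root of `φ` in each of the
`n` intervals cut out by `+∞, μ_1, …, μ_{n-1}, 0`.
-/

/-! ### The Desnanot–Jacobi identity -/

namespace Matrix

theorem det_updateCol_single {R : Type*} [CommRing R] {n : ℕ}
    (M : Matrix (Fin (n + 1)) (Fin (n + 1)) R) (i j : Fin (n + 1)) :
    (M.updateCol j (Pi.single i 1)).det =
      (-1) ^ (i + j : ℕ) * (M.submatrix i.succAbove j.succAbove).det := by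
  rw [← det_transpose, ← updateRow_transpose, ← adjugate_apply, adjugate_fin_succ_eq_det_submatrix,
    ← det_transpose (M.submatrix _ _), transpose_submatrix, add_comm (i : ℕ)]

theorem det_updateRow_add_single {R : Type*} [CommRing R] {n : ℕ}
    (M : Matrix (Fin (n + 1)) (Fin (n + 1)) R) (i j : Fin (n + 1)) (c : R) :
    (M.updateRow i (M i + c • Pi.single j 1)).det =
      M.det + c * ((-1) ^ (i + j : ℕ) * (M.submatrix i.succAbove j.succAbove).det) := by
  rw [det_updateRow_add, det_updateRow_smul, updateRow_eq_self, ← adjugate_apply,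
    adjugate_fin_succ_eq_det_submatrix]

/-- Jacobi's identity for `2 × 2` minors of the adjugate, when `det M` can be cancelled. The two
updated columns express the minor of `M` complementary to rows and columns `i`, `j`. -/
theorem det_mul_det_updateCol_updateCol_of_det_ne_zero {R n : Type*} [CommRing R] [IsDomain R]
    [Fintype n] [DecidableEq n] (M : Matrix n n R) (hM : M.det ≠ 0) {i j : n} (hij : i ≠ j) :
    M.det * ((M.updateCol i (Pi.single i 1)).updateCol j (Pi.single j 1)).det =
      M.adjugate i i * M.adjugate j j - M.adjugate i j * M.adjugate j i := by
  -- `X` is the identity with columns `i` and `j` replaced by those of the adjugate; both sides come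
  -- from computing `det (M * X)`.
  set X : Matrix n n R :=
    ((1 : Matrix n n R).updateCol i (fun k => M.adjugate k i)).updateCol j
      (fun k => M.adjugate k j) with hX
  have hcol : ∀ l, M *ᵥ (fun k => M.adjugate k l) = M.det • Pi.single l 1 := by
    intro l
    have h := congrArg (fun N : Matrix n n R => N.col l) M.mul_adjugate
    ext k
    have := congrFun h k
    simpa [Matrix.mul_apply, mulVec, dotProduct, Matrix.one_apply, Pi.single_apply] using this
  have h1 : M * X =
      (M.updateCol i (M.det • Pi.single i 1)).updateCol j (M.det • Pi.single j 1) := by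
    rw [hX, mul_updateCol, mul_updateCol, mul_one, hcol, hcol]
  have h2 : X.det = M.adjugate i i * M.adjugate j j - M.adjugate i j * M.adjugate j i := by
    -- `X` differs from `1` by a matrix of rank two, so Sylvester's identity reduces `det X` to a
    -- `2 × 2` determinant.
    let U : Matrix n (Fin 2) R := of fun k => ![M.adjugate k i - (1 : Matrix n n R) k i,
      M.adjugate k j - (1 : Matrix n n R) k j]
    let V : Matrix (Fin 2) n R := of ![Pi.single i 1, Pi.single j 1]
    have hXUV : X = 1 + U * V := by
      ext k l
      by_cases hj : l = j
      · subst hj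
        simp [hX, U, V, Matrix.mul_apply, Fin.sum_univ_two, hij.symm]
      · by_cases hi : l = i
        · subst hi
          simp [hX, U, V, Matrix.mul_apply, Fin.sum_univ_two, hij]
        · simp [hX, U, V, Matrix.mul_apply, Fin.sum_univ_two, hi, hj]
    rw [hXUV, det_one_add_mul_comm, det_fin_two]
    simp [U, V, hij, hij.symm]
  have h3 : ((M.updateCol i (M.det • Pi.single i 1)).updateCol j (M.det • Pi.single j 1)).det =
      M.det * (M.det *
        ((M.updateCol i (Pi.single i 1)).updateCol j (Pi.single j 1)).det) := by
    rw [det_updateCol_smul, updateCol_comm _ hij, det_updateCol_smul, updateCol_comm _ hij]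
  have h4 := congrArg det h1
  rw [det_mul, h3, h2] at h4
  exact (mul_left_cancel₀ hM h4).symm

/-- Jacobi's identity for `2 × 2` minors of the adjugate, over any commutative ring: it is
specialized from the generic matrix, whose determinant is not zero. -/
theorem det_mul_det_updateCol_updateCol {R n : Type*} [CommRing R]
    [Fintype n] [DecidableEq n] (M : Matrix n n R) {i j : n} (hij : i ≠ j) :
    M.det * ((M.updateCol i (Pi.single i 1)).updateCol j (Pi.single j 1)).det =
      M.adjugate i i * M.adjugate j j - M.adjugate i j * M.adjugate j i := by
  have h := congrArg (MvPolynomial.eval₂Hom (Int.castRingHom R) fun p : n × n => M p.1 p.2)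
    (det_mul_det_updateCol_updateCol_of_det_ne_zero (mvPolynomialX n n ℤ)
      (det_mvPolynomialX_ne_zero n ℤ) hij)
  set f := MvPolynomial.eval₂Hom (Int.castRingHom R) fun p : n × n => M p.1 p.2
  have hM : f.mapMatrix (mvPolynomialX n n ℤ) = M := by
    ext k l
    simp [f]
  have hs : ∀ k, (fun l => f ((Pi.single k 1 : n → MvPolynomial (n × n) ℤ) l)) = Pi.single k 1 := by
    intro k
    ext l
    simp [Pi.single_apply, apply_ite f]
  have hadj : ∀ k l, f ((mvPolynomialX n n ℤ).adjugate k l) = M.adjugate k l := by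
    intro k l
    rw [← hM, ← RingHom.map_adjugate]
    rfl
  have hu : ∀ (N : Matrix n n (MvPolynomial (n × n) ℤ)) k,
      f.mapMatrix (N.updateCol k (Pi.single k 1)) =
        (f.mapMatrix N).updateCol k (Pi.single k 1) := by
    intro N k
    rw [RingHom.mapMatrix_apply, map_updateCol, RingHom.mapMatrix_apply]
    congr 1
    exact hs k
  rw [map_mul, map_sub, map_mul, map_mul, RingHom.map_det, RingHom.map_det, hu, hu, hM, hadj, hadj,
    hadj, hadj] at h
  exact h

/-- The **Desnanot–Jacobi identity** (Dodgson condensation). -/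
theorem det_mul_det_interior {R : Type*} [CommRing R] {m : ℕ}
    (M : Matrix (Fin (m + 2)) (Fin (m + 2)) R) :
    M.det * (M.submatrix (fun i : Fin m => i.succ.castSucc) (fun i => i.succ.castSucc)).det =
      (M.submatrix Fin.succ Fin.succ).det * (M.submatrix Fin.castSucc Fin.castSucc).det -
        (M.submatrix Fin.succ Fin.castSucc).det * (M.submatrix Fin.castSucc Fin.succ).det := by
  have h := det_mul_det_updateCol_updateCol M (i := 0) (j := Fin.last (m + 1))
    (Fin.last_pos).ne
  have hint : ((M.updateCol 0 (Pi.single 0 1)).updateCol (Fin.last (m + 1))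
      (Pi.single (Fin.last (m + 1)) 1)).det =
      (M.submatrix (fun i : Fin m => i.succ.castSucc) (fun i => i.succ.castSucc)).det := by
    have hsub : (M.updateCol 0 (Pi.single 0 1)).submatrix Fin.castSucc Fin.castSucc =
        (M.submatrix Fin.castSucc Fin.castSucc).updateCol 0 (Pi.single 0 1) := by
      ext i j
      by_cases hj : j = 0
      · subst hj
        simp [Pi.single_apply]
      · simp [updateCol_ne, hj]
    rw [det_updateCol_single, Fin.succAbove_last, hsub, det_updateCol_single, Fin.succAbove_zero,
      submatrix_submatrix, Even.neg_one_pow ⟨_, rfl⟩]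
    simp only [Fin.val_zero, add_zero, pow_zero, one_mul]
    rfl
  rw [hint] at h
  rw [h]
  simp only [adjugate_fin_succ_eq_det_submatrix, Fin.succAbove_zero, Fin.succAbove_last]
  have e : ((-1 : R) ^ (m + 1)) * (-1) ^ (m + 1) = 1 := by
    rw [← mul_pow]; simp
  simp only [Fin.val_zero, Fin.val_last, add_zero, zero_add, pow_zero, pow_add _ (m + 1), e]
  linear_combination (-(M.submatrix Fin.succ Fin.castSucc).det *
    (M.submatrix Fin.castSucc Fin.succ).det) * e
end Matrix

/-! ### Corner minors of shifted strictly Kotelyansky matrices -/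

namespace IsSK

theorem submatrix {n k : ℕ} {A : Matrix (Fin n) (Fin n) ℝ} (hA : IsSK A) (f : Fin k ↪o Fin n) :
    IsSK (A.submatrix f f) where
  principal_pos l g := hA.principal_pos l (g.trans f)
  almost_principal_pos l g r s hrs := hA.almost_principal_pos l (g.trans f) r s hrs

theorem delete {n : ℕ} {A : Matrix (Fin (n + 1)) (Fin (n + 1)) ℝ} (hA : IsSK A)
    (r : Fin (n + 1)) : IsSK (deleteRowCol A r) :=
  hA.submatrix (Fin.succAboveOrderEmb r)

theorem transpose {n : ℕ} {A : Matrix (Fin n) (Fin n) ℝ} (hA : IsSK A) : IsSK A.transpose where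
  principal_pos k f := by
    rw [← Matrix.transpose_submatrix, Matrix.det_transpose]
    exact hA.principal_pos k f
  almost_principal_pos k f r s hrs := by
    rw [← Matrix.transpose_submatrix, Matrix.det_transpose]
    exact hA.almost_principal_pos k f s r hrs.symm

theorem det_corner_pos {m : ℕ} {A : Matrix (Fin (m + 2)) (Fin (m + 2)) ℝ} (hA : IsSK A) :
    0 < (A.submatrix Fin.succ Fin.castSucc).det := by
  have h := hA.almost_principal_pos (m + 1) (RelEmbedding.refl _) 0 (Fin.last _)
    Fin.last_pos.ne
  simp only [Fin.succAbove_zero, Fin.succAbove_last] at h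
  exact h

/-- Subtracting a nonnegative diagonal matrix keeps the lower left corner minor positive: every
index strictly between the first and the last sits between the deleted row and the deleted column,
so its diagonal entry has cofactor sign `-1`, and lowering it by `d` adds `d` times the corner minor
of the matrix without that index. -/
theorem det_corner_sub_diagonal_pos {m : ℕ} {A : Matrix (Fin (m + 2)) (Fin (m + 2)) ℝ}
    (hA : IsSK A) {d : Fin (m + 2) → ℝ} (hd : ∀ i, 0 ≤ d i) :
    0 < ((A - Matrix.diagonal d).submatrix Fin.succ Fin.castSucc).det := by
  -- Shift the diagonal entries one at a time; `S` is the set of those already shifted.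
  suffices H : ∀ S : Finset (Fin (m + 2)),
      0 < ((A - Matrix.diagonal fun i => if i ∈ S then d i else 0).submatrix
        Fin.succ Fin.castSucc).det by
    simpa using H Finset.univ
  induction m with
  | zero =>
    intro S
    simpa [Matrix.diagonal_apply] using hA.det_corner_pos
  | succ m ih =>
    intro S
    induction S using Finset.induction_on with
    | empty => simpa using hA.det_corner_pos
    | insert p S hp ihS =>
      set N := (A - Matrix.diagonal fun i => if i ∈ S then d i else 0).submatrix
        Fin.succ Fin.castSucc with hN
      have hentry : ∀ i j,
          (A - Matrix.diagonal fun i => if i ∈ insert p S then d i else 0).submatrix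
          Fin.succ Fin.castSucc i j = N i j - if i.succ = p ∧ j.castSucc = p then d p else 0 := by
        intro i j
        simp only [hN, Matrix.submatrix_apply, Matrix.sub_apply, Matrix.diagonal_apply,
          Finset.mem_insert]
        by_cases hi : i.succ = p
        · by_cases hj : j.castSucc = p
          · simp [hi, hj, hp]
          · simp [hi, hj, Ne.symm hj]
        · by_cases hij : i.succ = j.castSucc
          · simp [← hij, hi]
          · simp [hij, hi]
      by_cases hint : ∃ q : Fin (m + 1), p = q.succ.castSucc
      · obtain ⟨q, rfl⟩ := hint
        have hupd : (A - Matrix.diagonal fun i =>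
            if i ∈ insert q.succ.castSucc S then d i else 0).submatrix Fin.succ Fin.castSucc =
            N.updateRow q.castSucc
              (N q.castSucc + (-d q.succ.castSucc) • Pi.single q.succ 1) := by
          ext i j
          have hiq : i.succ = q.succ.castSucc ↔ i = q.castSucc := by
            rw [← Fin.succ_castSucc, Fin.succ_inj]
          simp only [hentry, hiq, Fin.castSucc_inj]
          by_cases hi : i = q.castSucc
          · subst hi
            by_cases hj : j = q.succ
            · subst hj; simp [sub_eq_add_neg]
            · simp [hj]
          · simp [hi]
        have hminor : N.submatrix q.castSucc.succAbove q.succ.succAbove =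
            (deleteRowCol A q.succ.castSucc - Matrix.diagonal fun i =>
              if i ∈ Finset.univ.filter (fun i => q.succ.castSucc.succAbove i ∈ S)
              then d (q.succ.castSucc.succAbove i) else 0).submatrix Fin.succ Fin.castSucc := by
          ext i j
          have h1 : (q.castSucc.succAbove i).succ = q.succ.castSucc.succAbove i.succ := by
            rw [← Fin.succ_castSucc, Fin.succ_succAbove_succ]
          have h2 : (q.succ.succAbove j).castSucc = q.succ.castSucc.succAbove j.castSucc := by
            rw [Fin.castSucc_succAbove_castSucc]
          simp only [hN, Matrix.submatrix_apply, Matrix.sub_apply, Matrix.diagonal_apply, h1, h2,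
            deleteRowCol, Finset.mem_filter, Finset.mem_univ, true_and,
            Fin.succAbove_right_inj]
        have hpos := ih (hA.delete q.succ.castSucc)
          (d := fun i => d (q.succ.castSucc.succAbove i)) (fun i => hd _)
          (Finset.univ.filter (fun i => q.succ.castSucc.succAbove i ∈ S))
        have hsign : (-1 : ℝ) ^ ((q.castSucc : ℕ) + (q.succ : ℕ)) = -1 :=
          Odd.neg_one_pow ⟨q, by simp; ring⟩
        rw [hupd, Matrix.det_updateRow_add_single, hminor, hsign]
        have := mul_nonneg (hd q.succ.castSucc) hpos.le
        linarith
      -- The first and the last diagonal entry do not occur in the corner minor.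
      · have : (A - Matrix.diagonal fun i => if i ∈ insert p S then d i else 0).submatrix
            Fin.succ Fin.castSucc = N := by
          ext i j
          rw [hentry, if_neg, sub_zero]
          rintro ⟨hi, hj⟩
          apply hint
          have hj0 : j ≠ 0 := by
            rintro rfl
            exact Fin.succ_ne_zero i (hi.trans hj.symm)
          obtain ⟨q, rfl⟩ := Fin.exists_succ_eq.mpr hj0
          exact ⟨q, hj.symm⟩
        rw [this]
        exact ihS

end IsSK

open Polynomial

/-! ### Roots of polynomials from alternating signs -/

/-- A monic polynomial of degree `n` that alternates in sign along `n + 1` decreasing points,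
starting with a positive value, splits with one simple root in each gap. -/
theorem Polynomial.exists_strictAnti_roots {n : ℕ} {p : ℝ[X]} (hp : p.Monic)
    (hdeg : p.natDegree = n) {t : Fin (n + 1) → ℝ} (ht : StrictAnti t)
    (hsign : ∀ i : Fin (n + 1), 0 < (-1) ^ (i : ℕ) * p.eval (t i)) :
    ∃ z : Fin n → ℝ, StrictAnti z ∧ p = ∏ i, (X - C (z i)) ∧
      ∀ i : Fin n, z i < t i.castSucc ∧ t i.succ < z i := by
  have hroot : ∀ i : Fin n, ∃ z, p.eval z = 0 ∧ z < t i.castSucc ∧ t i.succ < z := by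
    intro i
    have hlt : t i.succ < t i.castSucc := ht Fin.castSucc_lt_succ
    have h1 := hsign i.castSucc
    have h2 := hsign i.succ
    rw [Fin.val_castSucc] at h1
    rw [Fin.val_succ, pow_succ] at h2
    have hcont : ContinuousOn (fun x => (-1 : ℝ) ^ (i : ℕ) * p.eval x)
        (Set.Icc (t i.succ) (t i.castSucc)) := by fun_prop
    obtain ⟨z, hz, hz0⟩ := intermediate_value_Ioo hlt.le hcont
      (show (0 : ℝ) ∈ Set.Ioo _ _ from ⟨by linarith, h1⟩)
    exact ⟨z, by simpa using hz0, hz.2, hz.1⟩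
  choose z hz hzt using hroot
  have hanti : StrictAnti z := by
    intro i j hij
    exact (hzt j).1.trans_le
      ((ht.antitone (Fin.succ_le_castSucc_iff.mpr hij)).trans (hzt i).2.le)
  refine ⟨z, hanti, ?_, hzt⟩
  have hq : (∏ i, (X - C (z i))).Monic := monic_prod_X_sub_C _ _
  refine eq_of_degree_sub_lt_of_eval_index_eq Finset.univ hanti.injective.injOn ?_ ?_
  · rcases eq_or_ne n 0 with rfl | hn
    · simp [hp.natDegree_eq_zero.mp hdeg]
    · have hqdeg : (∏ i, (X - C (z i))).natDegree = n := by simp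
      refine (degree_sub_lt_left ?_ hp.ne_zero ?_).trans_le ?_
      · rw [degree_eq_natDegree hp.ne_zero, degree_eq_natDegree hq.ne_zero, hdeg, hqdeg]
      · rw [hp.leadingCoeff, hq.leadingCoeff]
      · rw [degree_eq_natDegree hp.ne_zero, hdeg, Finset.card_univ, Fintype.card_fin]
  · intro i _
    rw [hz i, eval_prod, Finset.prod_eq_zero (Finset.mem_univ i)]
    simp

/-- The polynomial with roots `nu` alternates in sign along any `mu` that it interlaces. -/
theorem neg_one_pow_mul_prod_sub_pos {n : ℕ} {mu : Fin (n + 1) → ℝ} {nu : Fin n → ℝ}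
    (hmu : StrictAnti mu) (h : ∀ i : Fin n, nu i < mu i.castSucc ∧ mu i.succ < nu i)
    (j : Fin (n + 1)) : 0 < (-1) ^ (j : ℕ) * ∏ i, (mu j - nu i) := by
  -- Exactly the `j` factors with `i < j` are negative.
  have hcard : (-1 : ℝ) ^ (j : ℕ) = ∏ i : Fin n, if i.castSucc < j then -1 else 1 := by
    rw [Finset.prod_ite, Finset.prod_const, Finset.prod_const_one, mul_one]
    congr 1
    have : (Finset.univ.filter fun i : Fin n => i.castSucc < j).card = (j : ℕ) := by
      rw [← Finset.card_map Fin.castSuccEmb]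
      conv_rhs => rw [← Fin.card_Iio j]
      congr 1
      ext k
      simp only [Finset.mem_map, Finset.mem_filter, Finset.mem_univ, true_and, Finset.mem_Iio]
      constructor
      · rintro ⟨i, hi, rfl⟩
        exact hi
      · intro hk
        exact ⟨k.castPred (Fin.ne_last_of_lt hk), by simpa using hk, by simp⟩
    exact this.symm
  rw [hcard, ← Finset.prod_mul_distrib]
  refine Finset.prod_pos fun i _ => ?_
  split_ifs with hij
  · have : mu j ≤ mu i.succ := hmu.antitone (Fin.castSucc_lt_iff_succ_le.mp hij)
    linarith [(h i).2]
  · have : mu i.castSucc ≤ mu j := hmu.antitone (not_lt.mp hij)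
    linarith [(h i).1]

/-! ### Matrices with simple positive spectrum -/

namespace HasSimplePosEigenvalues

theorem eval_charpoly_eq_zero_iff {n : ℕ} {A : Matrix (Fin n) (Fin n) ℝ} {ev : Fin n → ℝ}
    (h : HasSimplePosEigenvalues A ev) (x : ℝ) : A.charpoly.eval x = 0 ↔ x ∈ Set.range ev := by
  simp [h.charpoly_eq, eval_prod, Finset.prod_eq_zero_iff, sub_eq_zero, @eq_comm _ x]

theorem unique {n : ℕ} {A : Matrix (Fin n) (Fin n) ℝ} {ev ev' : Fin n → ℝ}
    (h : HasSimplePosEigenvalues A ev) (h' : HasSimplePosEigenvalues A ev') : ev = ev' := by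
  rw [← h.strictAnti.range_inj h'.strictAnti]
  ext x
  rw [← h.eval_charpoly_eq_zero_iff, h'.eval_charpoly_eq_zero_iff]

theorem spectralRadius_eq {n : ℕ} {A : Matrix (Fin (n + 1)) (Fin (n + 1)) ℝ}
    {ev : Fin (n + 1) → ℝ} (h : HasSimplePosEigenvalues A ev) :
    spectralRadius ℂ (A.map (fun x : ℝ => (x : ℂ))) = ENNReal.ofReal (ev 0) := by
  have hspec : ∀ k : ℂ, k ∈ spectrum ℂ (A.map (fun x : ℝ => (x : ℂ))) ↔ ∃ i, (ev i : ℂ) = k := by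
    intro k
    have hmap : (A.map (fun x : ℝ => (x : ℂ))).charpoly = A.charpoly.map Complex.ofRealHom :=
      A.charpoly_map Complex.ofRealHom
    rw [Matrix.mem_spectrum_iff_isRoot_charpoly, hmap, h.charpoly_eq]
    simp [Polynomial.map_prod, eval_prod, Finset.prod_eq_zero_iff, sub_eq_zero, @eq_comm _ k]
  have hnorm : ∀ i, (‖(ev i : ℂ)‖₊ : ENNReal) = ENNReal.ofReal (ev i) := by
    intro i
    rw [← enorm_eq_nnnorm, ← ofReal_norm, Complex.norm_real, Real.norm_of_nonneg (h.pos i).le]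
  apply le_antisymm
  · refine iSup₂_le fun k hk => ?_
    obtain ⟨i, rfl⟩ := (hspec k).mp hk
    rw [hnorm]
    exact ENNReal.ofReal_le_ofReal (h.strictAnti.antitone (Fin.zero_le i))
  · rw [← hnorm]
    exact le_iSup₂ (f := fun (k : ℂ) (_ : k ∈ spectrum ℂ _) => (‖k‖₊ : ENNReal)) (ev 0 : ℂ)
      ((hspec _).mpr ⟨0, rfl⟩)

end HasSimplePosEigenvalues

/-! ### Interlacing for strictly Kotelyansky matrices -/

namespace IsSK

theorem det_corner_mul_det_corner_pos {m : ℕ} {A : Matrix (Fin (m + 2)) (Fin (m + 2)) ℝ}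
    (hA : IsSK A) {x : ℝ} (hx : 0 ≤ x) :
    0 < ((Matrix.scalar (Fin (m + 2)) x - A).submatrix Fin.succ Fin.castSucc).det *
      ((Matrix.scalar (Fin (m + 2)) x - A).submatrix Fin.castSucc Fin.succ).det := by
  have h1 := hA.det_corner_sub_diagonal_pos (d := fun _ => x) fun _ => hx
  have h2 := hA.transpose.det_corner_sub_diagonal_pos (d := fun _ => x) fun _ => hx
  rw [← Matrix.det_transpose, Matrix.transpose_submatrix, Matrix.transpose_sub,
    Matrix.transpose_transpose, Matrix.diagonal_transpose] at h2
  have hneg : Matrix.scalar (Fin (m + 2)) x - A = -(A - Matrix.diagonal fun _ => x) := by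
    rw [neg_sub, Matrix.scalar_apply]
  rw [hneg, Matrix.submatrix_neg]
  simp only [Pi.neg_apply]
  rw [Matrix.det_neg, Matrix.det_neg, mul_mul_mul_comm, ← mul_pow]
  simpa using mul_pos h1 h2

/-- At a nonnegative eigenvalue of either one-step deletion, the Desnanot–Jacobi identity for `x - A`
leaves only minus the product of the corner minors. -/
theorem eval_charpoly_mul_eval_charpoly_interior_neg {m : ℕ}
    {A : Matrix (Fin (m + 2)) (Fin (m + 2)) ℝ} (hA : IsSK A) {x : ℝ} (hx : 0 ≤ x)
    (h : (deleteRowCol A 0).charpoly.eval x *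
      (deleteRowCol A (Fin.last _)).charpoly.eval x = 0) :
    A.charpoly.eval x *
      (deleteRowCol (deleteRowCol A 0) (Fin.last m)).charpoly.eval x < 0 := by
  have hsub : ∀ {k : ℕ} (f : Fin k → Fin (m + 2)), Function.Injective f →
      (A.submatrix f f).charpoly.eval x =
        ((Matrix.scalar (Fin (m + 2)) x - A).submatrix f f).det := by
    intro k f hf
    rw [Matrix.eval_charpoly]
    congr 1
    ext i j
    simp [Matrix.diagonal_apply, hf.eq_iff]
  have key := (Matrix.scalar (Fin (m + 2)) x - A).det_mul_det_interior
  rw [← hsub _ (Fin.succ_injective _), ← hsub _ (Fin.castSucc_injective _),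
    ← hsub (fun i : Fin m => i.succ.castSucc)
      ((Fin.castSucc_injective _).comp (Fin.succ_injective _)),
    ← Matrix.eval_charpoly] at key
  have hcorner := hA.det_corner_mul_det_corner_pos hx
  have h0 : deleteRowCol A 0 = A.submatrix Fin.succ Fin.succ := by
    simp [deleteRowCol]
  have hl : deleteRowCol A (Fin.last _) = A.submatrix Fin.castSucc Fin.castSucc := by
    simp [deleteRowCol]
  have hi : deleteRowCol (deleteRowCol A 0) (Fin.last m) =
      A.submatrix (fun i : Fin m => i.succ.castSucc) (fun i => i.succ.castSucc) := by
    ext i j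
    simp [deleteRowCol]
  rw [h0, hl] at h
  rw [hi, key, h]
  linarith

/-- If the characteristic polynomial of `A` alternates in sign along positive points `mu`, starting
with a negative value at the largest one, then its roots are simple, positive and interlaced
with `mu`. -/
theorem exists_interlacing {n : ℕ} {A : Matrix (Fin (n + 1)) (Fin (n + 1)) ℝ} (hA : IsSK A)
    {mu : Fin n → ℝ} (hanti : StrictAnti mu) (hpos : ∀ i, 0 < mu i)
    (hsign : ∀ j : Fin n, 0 < (-1) ^ (j + 1 : ℕ) * A.charpoly.eval (mu j)) :
    ∃ lam : Fin (n + 1) → ℝ, HasSimplePosEigenvalues A lam ∧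
      ∀ j : Fin n, mu j < lam j.castSucc ∧ lam j.succ < mu j := by
  have hmonic := A.charpoly_monic
  have hdeg : A.charpoly.natDegree = n + 1 := by simp
  obtain ⟨b, hb, hbmu⟩ : ∃ b, 0 < A.charpoly.eval b ∧ ∀ y ∈ insert 0 (Set.range mu), y < b := by
    have htop := A.charpoly.tendsto_atTop_of_leadingCoeff_nonneg
      (by rw [← natDegree_pos_iff_degree_pos, hdeg]; omega) (by rw [hmonic.leadingCoeff]; simp)
    have hfin : (insert 0 (Set.range mu)).Finite := (Set.finite_range mu).insert 0
    exact ((htop.eventually_gt_atTop 0).and ((Filter.eventually_all_finite hfin).mpr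
      fun y _ => Filter.eventually_gt_atTop y)).exists
  have h0 : 0 < (-1) ^ (n + 1) * A.charpoly.eval 0 := by
    rw [Matrix.eval_charpoly, map_zero, zero_sub, Matrix.det_neg, Fintype.card_fin, ← mul_assoc,
      ← mul_pow]
    simpa using hA.principal_pos (n + 1) (RelEmbedding.refl _)
  -- The `n + 2` separating points `b > mu 0 > ⋯ > mu (n - 1) > 0`.
  let t : Fin (n + 2) → ℝ := Fin.cons b (Fin.snoc mu 0)
  have ht0 : t 0 = b := rfl
  have ht1 : ∀ j : Fin n, t j.succ.castSucc = mu j := by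
    intro j
    rw [← Fin.succ_castSucc]
    simp [t]
  have ht2 : t (Fin.last _) = 0 := by
    rw [← Fin.succ_last]
    simp [t]
  have ht : StrictAnti t := by
    rw [Fin.strictAnti_iff_succ_lt]
    intro i
    induction i using Fin.lastCases with
    | last =>
      rw [Fin.succ_last, ht2]
      rcases Nat.eq_zero_or_pos n with rfl | hn
      · exact hbmu 0 (by simp)
      · obtain ⟨k, rfl⟩ : ∃ k, n = k + 1 := ⟨n - 1, by omega⟩
        rw [← Fin.succ_last, ht1]
        exact hpos _
    | cast i =>
      rw [Fin.succ_castSucc, ht1]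
      cases n with
      | zero => exact i.elim0
      | succ k =>
        induction i using Fin.cases with
        | zero => exact hbmu _ (by simp)
        | succ i =>
          rw [← Fin.succ_castSucc, ht1]
          exact hanti Fin.castSucc_lt_succ
  have htsign : ∀ i : Fin (n + 2), 0 < (-1) ^ (i : ℕ) * A.charpoly.eval (t i) := by
    intro i
    induction i using Fin.cases with
    | zero => simpa [ht0] using hb
    | succ i =>
      induction i using Fin.lastCases with
      | last => rw [Fin.succ_last, ht2]; simpa using h0
      | cast i => rw [Fin.succ_castSucc, ht1]; simpa using hsign i
  obtain ⟨lam, hlam, heq, hint⟩ := exists_strictAnti_roots hmonic hdeg ht htsign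
  refine ⟨lam, ⟨hlam, fun i => ?_, heq⟩, fun j => ⟨?_, ?_⟩⟩
  · refine lt_of_le_of_lt ?_ (hint i).2
    rw [← ht2]
    exact ht.antitone (Fin.le_last _)
  · rw [← ht1 j, ← Fin.succ_castSucc]
    exact (hint j.castSucc).2
  · rw [← ht1 j]
    exact (hint j.succ).1

/-- The inductive step: interlacing between the deletion `r` and the interior passes to `A` and the
deletion `r`. -/
theorem exists_interlacing_of_interior {m : ℕ} {A : Matrix (Fin (m + 2)) (Fin (m + 2)) ℝ}
    (hA : IsSK A) {r : Fin (m + 2)} (hr : r = 0 ∨ r = Fin.last (m + 1))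
    {mu : Fin (m + 1) → ℝ} (hmu : HasSimplePosEigenvalues (deleteRowCol A r) mu)
    {nu : Fin m → ℝ}
    (hnu : HasSimplePosEigenvalues
      (deleteRowCol (deleteRowCol A 0) (Fin.last m)) nu)
    (hint : ∀ j : Fin m, nu j < mu j.castSucc ∧ mu j.succ < nu j) :
    ∃ lam : Fin (m + 2) → ℝ, HasSimplePosEigenvalues A lam ∧
      ∀ j : Fin (m + 1), mu j < lam j.castSucc ∧ lam j.succ < mu j := by
  refine hA.exists_interlacing hmu.strictAnti hmu.pos fun j => ?_
  have hroot := (hmu.eval_charpoly_eq_zero_iff (mu j)).mpr ⟨j, rfl⟩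
  have hneg := hA.eval_charpoly_mul_eval_charpoly_interior_neg (hmu.pos j).le (by
    rcases hr with rfl | rfl <;> simp [hroot])
  have halt := neg_one_pow_mul_prod_sub_pos hmu.strictAnti hint j
  have hev : (deleteRowCol (deleteRowCol A 0) (Fin.last m)).charpoly.eval (mu j) =
      ∏ i, (mu j - nu i) := by
    simp [hnu.charpoly_eq, eval_prod]
  rw [hev] at hneg
  have hsq : ((-1 : ℝ) ^ (j : ℕ)) * (-1) ^ (j : ℕ) = 1 := by rw [← mul_pow]; simp
  rw [pow_succ]
  by_contra hcon
  have h1 : 0 ≤ (-1) ^ (j : ℕ) * A.charpoly.eval (mu j) := by linarith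
  have h2 := mul_nonneg h1 halt.le
  rw [mul_mul_mul_comm, hsq, one_mul] at h2
  linarith

/-- The eigenvalues of `A` are simple and positive, and interlaced with those of both end deletions.
These are proved together, since either deletion of `A` has to be compared with the interior, which
is a last deletion of the first one and a first deletion of the last one. -/
theorem exists_eigenvalues_interlacing {n : ℕ} {A : Matrix (Fin (n + 1)) (Fin (n + 1)) ℝ}
    (hA : IsSK A) :
    ∃ lam : Fin (n + 1) → ℝ, HasSimplePosEigenvalues A lam ∧
      ∀ r : Fin (n + 1), r = 0 ∨ r = Fin.last n →
        ∃ mu : Fin n → ℝ, HasSimplePosEigenvalues (deleteRowCol A r) mu ∧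
          ∀ j : Fin n, mu j < lam j.castSucc ∧ lam j.succ < mu j := by
  induction n with
  | zero =>
    obtain ⟨lam, hlam, -⟩ := hA.exists_interlacing (mu := Fin.elim0) (fun i => i.elim0)
      (fun i => i.elim0) (fun i => i.elim0)
    refine ⟨lam, hlam, fun r _ => ⟨Fin.elim0, ⟨fun i => i.elim0, fun i => i.elim0, ?_⟩,
      fun i => i.elim0⟩⟩
    simp [Matrix.charpoly]
  | succ m ih =>
    have hcomm : deleteRowCol (deleteRowCol A (Fin.last (m + 1))) 0 =
        deleteRowCol (deleteRowCol A 0) (Fin.last m) := by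
      ext i j
      simp [deleteRowCol]
    have hstep : ∀ r : Fin (m + 2), r = 0 ∨ r = Fin.last (m + 1) →
        ∃ mu : Fin (m + 1) → ℝ, HasSimplePosEigenvalues (deleteRowCol A r) mu ∧
          ∃ lam : Fin (m + 2) → ℝ, HasSimplePosEigenvalues A lam ∧
            ∀ j : Fin (m + 1), mu j < lam j.castSucc ∧ lam j.succ < mu j := by
      intro r hr
      obtain ⟨mu, hmu, hdel⟩ := ih (hA.delete r)
      refine ⟨mu, hmu, ?_⟩
      rcases hr with rfl | rfl
      · obtain ⟨nu, hnu, hint⟩ := hdel (Fin.last m) (Or.inr rfl)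
        exact hA.exists_interlacing_of_interior (Or.inl rfl) hmu hnu hint
      · obtain ⟨nu, hnu, hint⟩ := hdel 0 (Or.inl rfl)
        rw [hcomm] at hnu
        exact hA.exists_interlacing_of_interior (Or.inr rfl) hmu hnu hint
    -- Both deletions produce eigenvalues of the same `A`; they agree by uniqueness.
    obtain ⟨-, -, lam, hlam, -⟩ := hstep 0 (Or.inl rfl)
    refine ⟨lam, hlam, fun r hr => ?_⟩
    obtain ⟨mu, hmu, lam', hlam', hint⟩ := hstep r hr
    obtain rfl := hlam.unique hlam'
    exact ⟨mu, hmu, hint⟩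

end IsSK

theorem theorem10 (n : ℕ) (A : Matrix (Fin (n + 1)) (Fin (n + 1)) ℝ) (hA : IsSK A) :
    ∃ lam : Fin (n + 1) → ℝ,
      HasSimplePosEigenvalues A lam ∧
      spectralRadius ℂ (A.map (fun x : ℝ => (x : ℂ))) = ENNReal.ofReal (lam 0) ∧
      ∀ r : Fin (n + 1), r = 0 ∨ r = Fin.last n →
        ∃ mu : Fin n → ℝ,
          HasSimplePosEigenvalues (deleteRowCol A r) mu ∧
          ∀ j : Fin n, mu j < lam j.castSucc ∧ lam j.succ < mu j := by
  obtain ⟨lam, hlam, hint⟩ := hA.exists_eigenvalues_interlacing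
  exact ⟨lam, hlam, hlam.spectralRadius_eq, hint⟩
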